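/- Let $\mathbb{D}$ be the open unit disc. A bounded linear operator $T$ on a complex Banach space $X$ is called Tadmor–Ritt if $\sigma(T)\subset\overline{\mathbb{D}}$ and $$C(T):=\sup_{|z|>1}\|(z-1)(zI-T)^{-1}\|<\infty .$$ The Besov space $B_{\infty,1}(\mathbb{D})$ consists of the holomorphic functions $f$ on $\mathbb{D}$ with $$\|f\|_B:=\sup_{z\in\mathbb{D}}|f(z)|+\int_0^1\max_{\alpha\in\mathbb{R}}|f'(re^{i\alpha})|\,dr<\infty .$$ Let $W_0(z)=1+z$ and, for $n\ge1$, let $W_n(z)=\sum_k\widehat W_n(k)z^k$, where $\widehat W_n(k)$ is the value at the integer $k$ of the function which vanishes outside $[2^{n-1},2^{n+1}]$, is affine on $[2^{n-1},2^n]$ and on $[2^n,2^{n+1}]$, equals $1$ at $2^n$ and $0$ at $2^{n-1}$ and $2^{n+1}$. For $f(z)=\sum_k\hat f(k)z^k$ holomorphic on $\mathbb{D}$, let $W_n*f$ be the polynomial $(W_n*f)(z)=\sum_k\widehat W_n(k)\hat f(k)z^k$, and let $$\|f\|_*:=\sum_{n=0}^\infty\ \sup_{z\in\mathbb{D}}|(W_n*f)(z)|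 .$$ There is an absolute constant $a>0$ such that for every complex Banach space $X$, every Tadmor–Ritt operator $T$ on $X$ and every $f\in B_{\infty,1}(\mathbb{D})$ the following hold: $\|f\|_*<\infty$; the series $$f(T):=\sum_{n=0}^\infty(W_n*f)(T)$$ converges absolutely in the operator norm, so that $f(T)$ is a well-defined bounded operator; and $$\|f(T)\|\le a\,C(T)\,\log(C(T)+1)\,\|f\|_* .$$ -/

import Mathlib

noncomputable section

namespace TadmorRitt

/-- The constant `C(T) = sup_{|z| > 1} ‖(z - 1) R(z, T)‖`, where `R(z, T) = (z I - T)⁻¹`. It is a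
real supremum, meaningful under the boundedness that is part of `IsTadmorRitt`. -/
def rittConst {X : Type*} [NormedAddCommGroup X] [NormedSpace ℂ X] (T : X →L[ℂ] X) : ℝ :=
  ⨆ z : {z : ℂ // 1 < ‖z‖}, ‖((z : ℂ) - 1) • resolvent T (z : ℂ)‖

/-- `T` is a Tadmor--Ritt operator: its spectrum lies in the closed unit disc and
`C(T) < ∞`. -/
def IsTadmorRitt {X : Type*} [NormedAddCommGroup X] [NormedSpace ℂ X] (T : X →L[ℂ] X) : Prop :=
  spectrum ℂ T ⊆ Metric.closedBall (0 : ℂ) 1 ∧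
    BddAbove (Set.range fun z : {z : ℂ // 1 < ‖z‖} => ‖((z : ℂ) - 1) • resolvent T (z : ℂ)‖)

/-- The supremum norm over the open unit disc, with values in `[0, ∞]`. -/
def supNorm (g : ℂ → ℂ) : ENNReal :=
  ⨆ z ∈ Metric.ball (0 : ℂ) 1, ‖g z‖ₑ

/-- `‖f‖_B = ‖f‖_∞ + ∫₀¹ max_α |f'(r e^{iα})| dr`, with values in `[0, ∞]`. -/
def besovNorm (f : ℂ → ℂ) : ENNReal :=
  supNorm f +
    ∫⁻ r in Set.Ioo (0 : ℝ) 1, ⨆ α : ℝ, ‖deriv f ((r : ℂ) * Complex.exp ((α : ℂ) * Complex.I))‖ₑ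

/-- Membership in the Besov space `B_{∞,1}` of the disc: `f` is holomorphic on the open unit disc
and `‖f‖_B < ∞`. -/
def MemBesov (f : ℂ → ℂ) : Prop :=
  DifferentiableOn ℂ f (Metric.ball (0 : ℂ) 1) ∧ besovNorm f < ⊤

/-- The `k`-th Taylor coefficient of `f` at `0`. -/
def taylorCoeff (f : ℂ → ℂ) (k : ℕ) : ℂ :=
  iteratedDeriv k f 0 / (k.factorial : ℂ)

/-- The product `(g * f)(z) = ∑ ĝ(k) f̂(k) z ^ k` of a polynomial `g` and a function `f` holomorphic
near `0`; it is a polynomial. -/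
def conv (g : Polynomial ℂ) (f : ℂ → ℂ) : Polynomial ℂ :=
  g.sum fun k a => Polynomial.monomial k (a * taylorCoeff f k)

/-- The piecewise linear function that is supported in `[2 ^ (n - 1), 2 ^ (n + 1)]`, is affine on
`[2 ^ (n - 1), 2 ^ n]` and on `[2 ^ n, 2 ^ (n + 1)]`, and equals `1` at `2 ^ n`. -/
def triangle (n : ℕ) (x : ℝ) : ℝ :=
  max 0 (min ((x - 2 ^ ((n : ℤ) - 1)) / 2 ^ ((n : ℤ) - 1)) ((2 ^ ((n : ℤ) + 1) - x) / 2 ^ (n : ℤ)))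

/-- The dyadic Fejér type polynomials: `W 0 = 1 + z`, and for `n ≥ 1` the coefficients of `W n` are
the values of `triangle n` at the integers (these vanish above `2 ^ (n + 1)`). -/
def W (n : ℕ) : Polynomial ℂ :=
  if n = 0 then 1 + Polynomial.X
  else ∑ k ∈ Finset.range (2 ^ (n + 1) + 1), Polynomial.monomial k ((triangle n (k : ℝ) : ℝ) : ℂ)

/-- `‖f‖_* = ∑ₙ ‖W n * f‖_∞`, with values in `[0, ∞]`. -/
def starNorm (f : ℂ → ℂ) : ENNReal :=
  ∑' n : ℕ, supNorm fun z => (conv (W n) f).eval z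

/-- The operator `f(T) = ∑ₙ (W n * f)(T)`, a series in the operator norm. -/
def besovCalculus {X : Type*} [NormedAddCommGroup X] [NormedSpace ℂ X] (T : X →L[ℂ] X)
    (f : ℂ → ℂ) : X →L[ℂ] X :=
  ∑' n : ℕ, Polynomial.aeval T (conv (W n) f)

end TadmorRitt

end

/-! It suffices to bound one dyadic block `p` by `‖p(T)‖ ≤ a C log(C + 1) ‖p‖_∞` with `a`
independent of the block; summing then gives both convergence and the estimate.

Let `p` have degree at most `2N` and vanish at `0` to order comparable with `N`. In the
Riesz–Dunford integral over `|z| = 1 + h`, `h = 1/N`, the degree bound keeps `p` of size `‖p‖_∞`,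
while the zero makes the antiderivative `P` of size `h ‖p‖_∞`. The resolvent at angle `θ` is at most
`π C / (h + |θ|)`. Estimating the whole integral by absolute values would cost `C log N`. Instead
this is done only for `|θ| ≤ h C`, where it costs `C log(1 + C)`; beyond, integration by parts
replaces `p R` by `P R²`, whose integral is `O(C)` times `C / (1 + C) ≤ log(1 + C)`. This is
`norm_integral_zero_pi_le_mul_log`, applied in `norm_aeval_le_mul_log`.

Finiteness of `‖f‖_*` is a separate matter. The derivative of a block is a combination of three
Fejér means of `f'`, so block `n + 1` is `O(2⁻ⁿ)` times the maximum of `|f'|` on any circle of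
radius between `1 - 2⁻ⁿ⁻¹` and `1` (`norm_eval_conv_W_succ_le`). Averaging over disjoint dyadic
intervals of radii bounds the sum by the Besov integral. -/

/-! ### Growth and antiderivatives of polynomials -/

open Polynomial in
/-- Growth of a polynomial of degree at most `d` outside a circle. -/
theorem Polynomial.norm_eval_le_of_norm_eval_le_on_sphere {p : ℂ[X]} {d : ℕ}
    (hd : p.natDegree ≤ d) {ρ B : ℝ} (hρ : 0 < ρ)
    (hB : ∀ z : ℂ, ‖z‖ = ρ → ‖p.eval z‖ ≤ B) {z : ℂ} (hz : ρ ≤ ‖z‖) :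
    ‖p.eval z‖ ≤ B * (‖z‖ / ρ) ^ d := by
  have key (w : ℂ) (hw : w ≠ 0) : (p.reflect d).eval w⁻¹ * w ^ d = p.eval w := by
    have := invertibleOfNonzero hw
    simpa [Polynomial.eval₂_id, Polynomial.eval₂_eq_eval_map] using
      Polynomial.eval₂_reflect_mul_pow (RingHom.id ℂ) w d p hd
  have hz0 : z ≠ 0 := norm_pos_iff.1 (hρ.trans_le hz)
  -- Inversion turns the exterior of the circle into the disc of radius `ρ⁻¹`, where the maximum
  -- principle applies to the reversed polynomial.
  have hmax : ‖(p.reflect d).eval z⁻¹‖ ≤ B / ρ ^ d := by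
    refine Complex.norm_le_of_forall_mem_frontier_norm_le (f := fun w => (p.reflect d).eval w)
      (U := Metric.ball (0 : ℂ) ρ⁻¹) Metric.isBounded_ball
      (Polynomial.differentiable _).diffContOnCl (fun w hw => ?_) ?_
    · rw [frontier_ball _ (inv_ne_zero hρ.ne'), mem_sphere_zero_iff_norm] at hw
      have hw0 : w ≠ 0 := norm_pos_iff.1 (hw ▸ inv_pos.2 hρ)
      have h1 := key w⁻¹ (inv_ne_zero hw0)
      rw [inv_inv] at h1
      have hn : ‖w⁻¹‖ = ρ := by rw [norm_inv, hw, inv_inv]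
      have h2 := hB w⁻¹ hn
      rw [← h1, norm_mul, norm_pow, hn] at h2
      rwa [le_div_iff₀ (by positivity)]
    · rw [closure_ball _ (inv_ne_zero hρ.ne'), mem_closedBall_zero_iff, norm_inv]
      exact inv_anti₀ hρ hz
  rw [← key z hz0, norm_mul, norm_pow, div_pow]
  calc _ ≤ B / ρ ^ d * ‖z‖ ^ d := by gcongr
    _ = _ := by ring

open Polynomial in
/-- An antiderivative of a polynomial with a zero of order `m` at the origin gains `1 / (m + 1)`. -/
theorem Polynomial.norm_eval_le_of_derivative_norm_le {p q : ℂ[X]} {m : ℕ}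
    (hp : derivative p = X ^ m * q) (hp0 : p.eval 0 = 0) {ρ B : ℝ} (hρ : 0 < ρ)
    (hB : ∀ z : ℂ, ‖z‖ = ρ → ‖(derivative p).eval z‖ ≤ B) {z : ℂ} (hz : ‖z‖ = ρ) :
    ‖p.eval z‖ ≤ ρ * B / (m + 1) := by
  have hq (w : ℂ) (hw : ‖w‖ ≤ ρ) : ‖q.eval w‖ ≤ B / ρ ^ m := by
    refine Complex.norm_le_of_forall_mem_frontier_norm_le (f := fun w => q.eval w)
      (U := Metric.ball (0 : ℂ) ρ) Metric.isBounded_ball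
      (Polynomial.differentiable _).diffContOnCl (fun w hw => ?_) ?_
    · rw [frontier_ball _ hρ.ne', mem_sphere_zero_iff_norm] at hw
      have h2 := hB w hw
      rw [hp, eval_mul, eval_pow, eval_X, norm_mul, norm_pow, hw] at h2
      rwa [le_div_iff₀' (by positivity)]
    · rwa [closure_ball _ hρ.ne', mem_closedBall_zero_iff]
  have hd (t : ℝ) : HasDerivAt (fun t : ℝ => p.eval ((t : ℂ) * z))
      ((derivative p).eval ((t : ℂ) * z) * z) t := by
    have h1 : HasDerivAt (fun t : ℝ => (t : ℂ) * z) z t := by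
      simpa using (Complex.ofRealCLM.hasDerivAt (x := t)).mul_const z
    exact (p.hasDerivAt ((t : ℂ) * z)).comp t h1
  -- The bound on `q` gives `|p'(tz)| ≤ B t ^ m` along the radius; the factor `1 / (m + 1)` is the
  -- integral of `t ^ m`.
  have hbd : ∀ t ∈ Set.Icc (0 : ℝ) 1, ‖p.eval ((t : ℂ) * z)‖ ≤ ρ * B / (m + 1) * t ^ (m + 1) := by
    refine image_norm_le_of_norm_deriv_right_le_deriv_boundary
      (fun t _ => (hd t).continuousAt.continuousWithinAt)
      (fun t _ => (hd t).hasDerivWithinAt) (B' := fun t => ρ * B * t ^ m) (by simp [hp0])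
      (fun t => ?_) (fun t ht => ?_)
    · refine ((hasDerivAt_pow (m + 1) t).const_mul (ρ * B / (m + 1))).congr_deriv ?_
      have : (m : ℝ) + 1 ≠ 0 := by positivity
      push_cast
      field_simp
    · have hn : ‖(t : ℂ) * z‖ = t * ρ := by
        rw [norm_mul, Complex.norm_real, Real.norm_of_nonneg ht.1, hz]
      rw [hp, norm_mul, eval_mul, eval_pow, eval_X, norm_mul, norm_pow, hn, hz]
      have := hq ((t : ℂ) * z) (by rw [hn]; nlinarith [ht.1, ht.2])
      have ht0 := ht.1
      calc (t * ρ) ^ m * ‖q.eval ((t : ℂ) * z)‖ * ρ ≤ (t * ρ) ^ m * (B / ρ ^ m) * ρ := by gcongr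
        _ = ρ * B * t ^ m := by field_simp; ring
  simpa using hbd 1 (by simp)

open Polynomial in
/-- Every complex polynomial has an antiderivative vanishing at the origin. -/
theorem Polynomial.exists_derivative_eq_and_eval_zero (p : ℂ[X]) :
    ∃ q : ℂ[X], derivative q = p ∧ q.eval 0 = 0 := by
  induction p using Polynomial.induction_on' with
  | add p q hp hq =>
    obtain ⟨P, rfl, hP⟩ := hp
    obtain ⟨Q, rfl, hQ⟩ := hq
    exact ⟨P + Q, by simp, by simp [hP, hQ]⟩
  | monomial n a =>
    refine ⟨monomial (n + 1) (a / (n + 1)), ?_, by simp⟩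
    rw [derivative_monomial]
    have : (n : ℂ) + 1 ≠ 0 := by exact_mod_cast n.succ_ne_zero
    simp [div_mul_cancel₀ _ this]

/-! ### The logarithmic integral estimate -/

-- The scale `h` must not survive in the bound. Absolute values are used on `[0, hC]`, integration
-- by parts with `V' = F - S` on the rest; at the cut `θ = hC` the ratio `(h + θ) / h` equals `1 +
-- C`.
open Real in
theorem norm_integral_zero_pi_le_mul_log {E : Type*} [NormedAddCommGroup E] [NormedSpace ℝ E]
    [CompleteSpace E] {F S V : ℝ → E} {A h C : ℝ} (hh : 0 < h) (hC : 0 < C) (hA : 0 ≤ A)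
    (hFc : ContinuousOn F (Set.Icc 0 π)) (hSc : ContinuousOn S (Set.Icc 0 π))
    (hV : ∀ θ ∈ Set.Icc 0 π, HasDerivAt V (F θ - S θ) θ)
    (hF : ∀ θ ∈ Set.Icc 0 π, ‖F θ‖ ≤ A * C / (h + θ))
    (hVb : ∀ θ ∈ Set.Icc 0 π, ‖V θ‖ ≤ A * h * C / (h + θ))
    (hSb : ∀ θ ∈ Set.Icc 0 π, ‖S θ‖ ≤ A * h * C ^ 2 / (h + θ) ^ 2) :
    ‖∫ θ in 0..π, F θ‖ ≤ 2 * A * (C + 1) * log (1 + C) := by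
  have hlog : C / (1 + C) ≤ log (1 + C) := by
    have := one_sub_inv_le_log_of_pos (show 0 < 1 + C by linarith)
    have h2 : 1 - (1 + C)⁻¹ = C / (1 + C) := by field_simp; ring
    linarith
  have hlog0 : 0 ≤ log (1 + C) := log_nonneg (by linarith)
  have near (b : ℝ) (hb0 : 0 ≤ b) (hb : b ≤ π) :
      ‖∫ θ in 0..b, F θ‖ ≤ A * C * (log (h + b) - log h) := by
    have hpos (t : ℝ) (ht : t ∈ Set.uIcc 0 b) : h + t ≠ 0 := by
      rw [Set.uIcc_of_le hb0] at ht
      linarith [ht.1]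
    have hint : IntervalIntegrable (fun θ => A * C / (h + θ)) MeasureTheory.volume 0 b :=
      (ContinuousOn.div (by fun_prop) (by fun_prop) hpos).intervalIntegrable
    refine (intervalIntegral.norm_integral_le_of_norm_le hb0
      (.of_forall fun t ht => hF t ⟨ht.1.le, ht.2.trans hb⟩) hint).trans_eq ?_
    rw [intervalIntegral.integral_eq_sub_of_hasDerivAt
      (f := fun θ => A * C * log (h + θ)) (fun t ht => ?_) hint]
    · simp [mul_sub]
    · refine ((((hasDerivAt_id t).const_add h).log (hpos t ht)).const_mul (A * C)).congr_deriv ?_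
      simp [div_eq_mul_inv]
  -- If the cut lies beyond `π`, the direct estimate covers the whole interval.
  rcases le_or_gt π (h * C) with hcase | hcase
  · refine (near π pi_pos.le le_rfl).trans ?_
    have h1 : log (h + π) ≤ log (h * (1 + C)) := log_le_log (by positivity) (by linarith)
    rw [log_mul hh.ne' (by linarith)] at h1
    calc A * C * (log (h + π) - log h) ≤ A * C * log (1 + C) := by gcongr; linarith
      _ ≤ 2 * A * (C + 1) * log (1 + C) := by
          rw [mul_assoc 2]
          have : A * C ≤ 2 * (A * (C + 1)) := by nlinarith
          rw [← mul_assoc]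
          calc A * C * log (1 + C) ≤ 2 * (A * (C + 1)) * log (1 + C) := by gcongr
            _ = _ := by ring
  · set b := h * C with hb
    have hb0 : 0 < b := by positivity
    have hpos (t : ℝ) (ht : t ∈ Set.uIcc b π) : h + t ≠ 0 := by
      rw [Set.uIcc_of_le hcase.le] at ht
      linarith [ht.1]
    have hsub : Set.uIcc b π ⊆ Set.Icc 0 π := by
      rw [Set.uIcc_of_le hcase.le]
      exact Set.Icc_subset_Icc_left hb0.le
    have hsub' : Set.uIcc 0 b ⊆ Set.Icc 0 π := by
      rw [Set.uIcc_of_le hb0.le]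
      exact Set.Icc_subset_Icc_right hcase.le
    have iF := (hFc.mono hsub).intervalIntegrable (μ := MeasureTheory.volume)
    have iF' := (hFc.mono hsub').intervalIntegrable (μ := MeasureTheory.volume)
    have iS := (hSc.mono hsub).intervalIntegrable (μ := MeasureTheory.volume)
    have hparts := intervalIntegral.integral_eq_sub_of_hasDerivAt
      (fun t ht => hV t (hsub ht)) (iF.sub iS)
    rw [intervalIntegral.integral_sub iF iS, sub_eq_iff_eq_add] at hparts
    have hS : ‖∫ θ in b..π, S θ‖ ≤ A * h * C ^ 2 * (h + b)⁻¹ := by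
      have hint : IntervalIntegrable (fun θ => A * h * C ^ 2 / (h + θ) ^ 2)
          MeasureTheory.volume b π :=
        (ContinuousOn.div (by fun_prop) (by fun_prop)
          fun t ht => pow_ne_zero 2 (hpos t ht)).intervalIntegrable
      refine (intervalIntegral.norm_integral_le_of_norm_le hcase.le
        (.of_forall fun t ht => hSb t ⟨(hb0.trans ht.1).le, ht.2⟩) hint).trans ?_
      rw [intervalIntegral.integral_eq_sub_of_hasDerivAt
        (f := fun θ => - (A * h * C ^ 2 * (h + θ)⁻¹)) (fun t ht => ?_) hint]
      · have : 0 ≤ A * h * C ^ 2 * (h + π)⁻¹ := by positivity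
        linarith
      · refine ((((hasDerivAt_id t).const_add h).fun_inv (hpos t ht)).const_mul
          (A * h * C ^ 2)).neg.congr_deriv ?_
        simp [div_eq_mul_inv]
    have e1 := near b hb0.le hcase.le
    have hhb : h + b = h * (1 + C) := by rw [hb]; ring
    have e2 := hVb b ⟨hb0.le, hcase.le⟩
    have e3 : ‖V π‖ ≤ A * h * C / (h + b) := by
      refine (hVb π ⟨pi_pos.le, le_rfl⟩).trans ?_
      gcongr
    have f2 : A * h * C / (h + b) = A * (C / (1 + C)) := by rw [hhb]; field_simp
    have f3 : A * h * C ^ 2 * (h + b)⁻¹ = A * C * (C / (1 + C)) := by rw [hhb]; field_simp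
    rw [f2] at e2 e3
    rw [f3] at hS
    rw [hhb, log_mul hh.ne' (by linarith), add_sub_cancel_left] at e1
    have g2 : A * (C / (1 + C)) ≤ A * log (1 + C) := by gcongr
    have g3 : A * C * (C / (1 + C)) ≤ A * C * log (1 + C) := by gcongr
    rw [← intervalIntegral.integral_add_adjacent_intervals iF' iF, hparts]
    have n1 := norm_add_le (∫ θ in 0..b, F θ) (V π - V b + ∫ θ in b..π, S θ)
    have n2 := norm_add_le (V π - V b) (∫ θ in b..π, S θ)
    have n3 := norm_sub_le (V π) (V b)
    calc _ ≤ A * C * log (1 + C) + (A * log (1 + C) + A * log (1 + C) + A * C * log (1 + C)) := by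
          linarith
      _ = _ := by ring

/-! ### Riesz–Dunford calculus outside the unit disc -/

section Resolvent

open Complex

variable {A : Type*} [NormedRing A] [NormedAlgebra ℂ A] [CompleteSpace A] {a : A}

theorem continuousOn_resolvent_of_forall_one_lt {s : Set ℂ}
    (hσ : ∀ z : ℂ, 1 < ‖z‖ → z ∈ resolventSet ℂ a) (hs : ∀ z ∈ s, 1 < ‖z‖) :
    ContinuousOn (resolvent a) s := fun z hz =>
  (spectrum.hasDerivAt_resolvent_const_left (hσ z (hs z hz))).continuousAt.continuousWithinAt

omit [CompleteSpace A] in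
theorem smul_resolvent_eq_one_add {z : ℂ} (hz : z ∈ resolventSet ℂ a) :
    z • resolvent a z = 1 + a * resolvent a z := by
  have h : (algebraMap ℂ A z - a) * resolvent a z = 1 := by
    rw [spectrum.resolvent_eq hz]
    exact hz.mul_val_inv
  rw [sub_mul, sub_eq_iff_eq_add, ← Algebra.smul_def] at h
  exact h

/-- The circle can be pushed out to any radius `ρ`, where the resolvent differs from `z⁻¹` by `z⁻¹ a
R(z)`. The growth condition makes the integral of this difference `O(1 / (ρ - 1))`. -/
theorem circleIntegral_resolvent {C : ℝ} (hσ : ∀ z : ℂ, 1 < ‖z‖ → z ∈ resolventSet ℂ a)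
    (hC : ∀ z : ℂ, 1 < ‖z‖ → ‖z - 1‖ * ‖resolvent a z‖ ≤ C) {R : ℝ} (hR : 1 < R) :
    ∮ z in C(0, R), resolvent a z = (2 * Real.pi * I : ℂ) • (1 : A) := by
  have hcont (ρ : ℝ) (hρ : 1 < ρ) : ContinuousOn (resolvent a) (Metric.sphere (0 : ℂ) ρ) :=
    continuousOn_resolvent_of_forall_one_lt hσ fun z hz => by
      rwa [mem_sphere_zero_iff_norm.1 hz]
  have hest (ρ : ℝ) (hρ : R ≤ ρ) :
      ‖(∮ z in C(0, R), resolvent a z) - (2 * Real.pi * I : ℂ) • (1 : A)‖ ≤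
        2 * Real.pi * (‖a‖ * C) / (ρ - 1) := by
    have hρ1 : 1 < ρ := hR.trans_le hρ
    have hρ0 : 0 < ρ := one_pos.trans hρ1
    have hann : ∮ z in C(0, ρ), resolvent a z = ∮ z in C(0, R), resolvent a z := by
      refine circleIntegral_eq_of_differentiable_on_annulus_off_countable (by linarith) hρ
        Set.countable_empty ?_ ?_
      · refine continuousOn_resolvent_of_forall_one_lt hσ fun z hz => ?_
        have := hz.2
        simp only [Metric.mem_ball, dist_zero_right, not_lt] at this
        linarith
      · rintro z ⟨⟨-, hz⟩, -⟩
        simp only [Metric.mem_closedBall, dist_zero_right, not_le] at hz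
        exact (spectrum.hasDerivAt_resolvent_const_left
          (hσ z (hR.trans hz))).differentiableAt
    have hinv : ∮ z in C(0, ρ), z⁻¹ • (1 : A) = (2 * Real.pi * I : ℂ) • (1 : A) := by
      rw [circleIntegral.integral_smul_const]
      have := circleIntegral.integral_sub_center_inv 0 hρ0.ne'
      simp only [sub_zero] at this
      rw [this]
    have hne (z : ℂ) (hz : z ∈ Metric.sphere (0 : ℂ) ρ) : z ≠ 0 := by
      rintro rfl
      simp at hz
      linarith
    have hci : CircleIntegrable (fun z => z⁻¹ • (1 : A)) 0 ρ :=
      (ContinuousOn.smul (continuousOn_id.inv₀ hne) continuousOn_const).circleIntegrable hρ0.le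
    rw [← hann, ← hinv, ← circleIntegral.integral_sub
      ((hcont ρ hρ1).circleIntegrable hρ0.le)
      hci]
    refine (circleIntegral.norm_integral_le_of_norm_le_const hρ0.le
      (C := ρ⁻¹ * (‖a‖ * (C / (ρ - 1)))) fun z hz => ?_).trans_eq ?_
    · have hz0 := hne z hz
      rw [mem_sphere_zero_iff_norm] at hz
      have hz1 : 1 < ‖z‖ := hz ▸ hρ1
      have : resolvent a z - z⁻¹ • (1 : A) = z⁻¹ • (a * resolvent a z) := by
        rw [eq_sub_of_add_eq' (smul_resolvent_eq_one_add (hσ z hz1)).symm, smul_sub,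
          inv_smul_smul₀ hz0]
      have hd : ρ - 1 ≤ ‖z - 1‖ := by
        have := norm_sub_norm_le z 1
        rwa [hz, norm_one] at this
      have hr : ‖resolvent a z‖ ≤ C / (ρ - 1) := by
        rw [le_div_iff₀' (by linarith)]
        exact (mul_le_mul_of_nonneg_right hd (norm_nonneg _)).trans (hC z hz1)
      rw [this, norm_smul, norm_inv, hz]
      gcongr
      exact (norm_mul_le _ _).trans (by gcongr)
    · field_simp
  have hlim : Filter.Tendsto (fun ρ : ℝ => 2 * Real.pi * (‖a‖ * C) / (ρ - 1)) Filter.atTop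
      (nhds 0) :=
    Filter.Tendsto.const_div_atTop (Filter.tendsto_atTop_add_const_right _ _ Filter.tendsto_id) _
  have := ge_of_tendsto hlim (Filter.eventually_atTop.2 ⟨R, hest⟩)
  exact sub_eq_zero.1 (norm_le_zero_iff.1 this)

/-- Induction on `k` through `z R(z) = 1 + a R(z)`: the first term contributes an entire integrand,
the second a factor `a`. -/
theorem circleIntegral_pow_smul_resolvent {C : ℝ}
    (hσ : ∀ z : ℂ, 1 < ‖z‖ → z ∈ resolventSet ℂ a)
    (hC : ∀ z : ℂ, 1 < ‖z‖ → ‖z - 1‖ * ‖resolvent a z‖ ≤ C) {R : ℝ} (hR : 1 < R) (k : ℕ) :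
    ∮ z in C(0, R), z ^ k • resolvent a z = (2 * Real.pi * I : ℂ) • a ^ k := by
  have hR0 : 0 ≤ R := by linarith
  have hmem (z : ℂ) (hz : z ∈ Metric.sphere (0 : ℂ) R) : 1 < ‖z‖ := by
    rwa [mem_sphere_zero_iff_norm.1 hz]
  have hcont := continuousOn_resolvent_of_forall_one_lt hσ hmem
  induction k with
  | zero => simpa using circleIntegral_resolvent hσ hC hR
  | succ k ih =>
    have hci : CircleIntegrable (fun z => z ^ k • resolvent a z) 0 R :=
      ((continuousOn_id.pow k).smul hcont).circleIntegrable hR0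
    have h1 : ∮ z in C(0, R), z ^ k • (1 : A) = 0 := by
      rw [circleIntegral.integral_smul_const,
        DiffContOnCl.circleIntegral_eq_zero hR0 (by fun_prop : Differentiable ℂ
          fun z : ℂ => z ^ k).diffContOnCl, zero_smul]
    have h2 : ∮ z in C(0, R), a * (z ^ k • resolvent a z) =
        a * ∮ z in C(0, R), z ^ k • resolvent a z := by
      have := (ContinuousLinearMap.mul ℂ A a).intervalIntegral_comp_comm hci.out
      simpa [circleIntegral] using this
    calc ∮ z in C(0, R), z ^ (k + 1) • resolvent a z
        = ∮ z in C(0, R), (z ^ k • (1 : A) + a * (z ^ k • resolvent a z)) := by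
          refine circleIntegral.integral_congr hR0 fun z hz => ?_
          rw [pow_succ, mul_smul, smul_resolvent_eq_one_add (hσ z (hmem z hz)), smul_add,
            mul_smul_comm]
      _ = (2 * Real.pi * I : ℂ) • a ^ (k + 1) := by
          rw [circleIntegral.integral_add, h1, h2, ih, zero_add, mul_smul_comm, pow_succ']
          · exact ((continuousOn_id.pow k).smul continuousOn_const).circleIntegrable hR0
          · exact (continuousOn_const.mul ((continuousOn_id.pow k).smul hcont)).circleIntegrable hR0

/-- The Riesz--Dunford formula for polynomials. -/
theorem circleIntegral_eval_smul_resolvent {C : ℝ}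
    (hσ : ∀ z : ℂ, 1 < ‖z‖ → z ∈ resolventSet ℂ a)
    (hC : ∀ z : ℂ, 1 < ‖z‖ → ‖z - 1‖ * ‖resolvent a z‖ ≤ C) {R : ℝ} (hR : 1 < R)
    (p : Polynomial ℂ) :
    ∮ z in C(0, R), p.eval z • resolvent a z =
      (2 * Real.pi * I : ℂ) • Polynomial.aeval a p := by
  have hR0 : 0 ≤ R := by linarith
  have hcont := continuousOn_resolvent_of_forall_one_lt (s := Metric.sphere (0 : ℂ) R) hσ
    fun z hz => by rwa [mem_sphere_zero_iff_norm.1 hz]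
  induction p using Polynomial.induction_on' with
  | add p q hp hq =>
    simp only [Polynomial.eval_add, add_smul, map_add, smul_add]
    rw [circleIntegral.integral_add, hp, hq]
    · exact (p.continuous.continuousOn.smul hcont).circleIntegrable hR0
    · exact (q.continuous.continuousOn.smul hcont).circleIntegrable hR0
  | monomial n c =>
    simp only [Polynomial.eval_monomial, Polynomial.aeval_monomial, mul_smul c]
    rw [circleIntegral.integral_smul, circleIntegral_pow_smul_resolvent hσ hC hR,
      ← Algebra.smul_def, smul_comm c]

end Resolvent

/-! ### The estimate for one dyadic block -/

-- The squared distance is `h² + 2(1 + h)(1 - cos θ)`, hence the distance is at least `h` and at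
-- least `2|θ| / π`; the claim follows by averaging.
open Real in
theorem norm_circleMap_sub_one_ge {h θ : ℝ} (hh : 0 ≤ h) (hθ : |θ| ≤ π) :
    (h + |θ|) / π ≤ ‖circleMap 0 (1 + h) θ - 1‖ := by
  have hsq : ‖circleMap 0 (1 + h) θ - 1‖ ^ 2 = h ^ 2 + 2 * (1 + h) * (1 - cos θ) := by
    have : circleMap 0 (1 + h) θ - 1 =
        (((1 + h) * cos θ - 1 : ℝ) : ℂ) + (((1 + h) * sin θ : ℝ) : ℂ) * Complex.I := by
      rw [circleMap, Complex.exp_mul_I]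
      push_cast
      ring
    rw [this, ← Complex.normSq_eq_norm_sq, Complex.normSq_add_mul_I]
    linear_combination (1 + h) ^ 2 * sin_sq_add_cos_sq θ
  have hcos := cos_le_one_sub_mul_cos_sq hθ
  have hπ := pi_gt_three
  have h1 : h ≤ ‖circleMap 0 (1 + h) θ - 1‖ := by
    refine le_of_sq_le_sq ?_ (norm_nonneg _)
    rw [hsq]
    nlinarith [cos_le_one θ]
  have h2 : 2 / π * |θ| ≤ ‖circleMap 0 (1 + h) θ - 1‖ := by
    refine le_of_sq_le_sq ?_ (norm_nonneg _)
    rw [hsq, mul_pow, sq_abs, div_pow]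
    have e : (2 : ℝ) ^ 2 / π ^ 2 * θ ^ 2 = 2 * (2 / π ^ 2 * θ ^ 2) := by ring
    rw [e]
    nlinarith [cos_le_one θ]
  have e2 : 2 / π * |θ| = 2 * (|θ| / π) := by ring
  have h3 : h / π ≤ h / 3 := by gcongr
  rw [add_div]
  linarith

section Resolvent

open Complex Polynomial

variable {A : Type*} [NormedRing A] [NormedAlgebra ℂ A] [CompleteSpace A] {a : A}

/-- The sign `s = ±1` selects the upper or lower half of the circle, both traversed away from the
point nearest `1`. -/
theorem norm_integral_zero_pi_resolvent_le {C : ℝ} (hC0 : 0 < C)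
    (hσ : ∀ z : ℂ, 1 < ‖z‖ → z ∈ resolventSet ℂ a)
    (hC : ∀ z : ℂ, 1 < ‖z‖ → ‖z - 1‖ * ‖resolvent a z‖ ≤ C) {h M : ℝ} (hh : 0 < h) (hh1 : h ≤ 1)
    (hM : 0 ≤ M) {p P : ℂ[X]} (hP : derivative P = p)
    (hpM : ∀ z : ℂ, ‖z‖ = 1 + h → ‖p.eval z‖ ≤ M)
    (hPM : ∀ z : ℂ, ‖z‖ = 1 + h → ‖P.eval z‖ ≤ 4 * M * h) {s : ℝ} (hs : |s| = 1) :
    ‖∫ θ in 0..Real.pi, (circleMap 0 (1 + h) (s * θ) * I) •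
      (p.eval (circleMap 0 (1 + h) (s * θ)) • resolvent a (circleMap 0 (1 + h) (s * θ)))‖ ≤
      16 * Real.pi ^ 2 * M * (C + 1) * Real.log (1 + C) := by
  set z : ℝ → ℂ := fun θ => circleMap 0 (1 + h) (s * θ) with hz
  have hzc : Continuous z := (continuous_circleMap 0 (1 + h)).comp (continuous_const_mul s)
  have hzn (θ : ℝ) : ‖z θ‖ = 1 + h := by
    simp only [hz, norm_circleMap_zero]
    exact abs_of_pos (by linarith)
  have hz1 (θ : ℝ) : 1 < ‖z θ‖ := by rw [hzn]; linarith
  have hrc : Continuous fun θ => resolvent a (z θ) := continuous_iff_continuousAt.2 fun θ =>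
    (spectrum.hasDerivAt_resolvent_const_left (hσ _ (hz1 θ))).continuousAt.comp hzc.continuousAt
  have hzd (θ : ℝ) : HasDerivAt z (s * (z θ * I)) θ := by
    have h1 : HasDerivAt (fun θ : ℝ => s * θ) s θ := by
      simpa using (hasDerivAt_id θ).const_mul s
    exact (hasDerivAt_circleMap 0 (1 + h) (s * θ)).scomp θ h1
  have hss : (s : ℂ) * s = 1 := by
    have : s * s = 1 := by rw [← abs_mul_abs_self, hs, one_mul]
    exact_mod_cast this
  have hr (θ : ℝ) (hθ : θ ∈ Set.Icc 0 Real.pi) :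
      ‖resolvent a (z θ)‖ ≤ Real.pi * C / (h + θ) := by
    have hsθ : |s * θ| = θ := by rw [abs_mul, hs, one_mul, abs_of_nonneg hθ.1]
    have hge := norm_circleMap_sub_one_ge (h := h) (θ := s * θ) hh.le (hsθ.symm ▸ hθ.2)
    rw [hsθ] at hge
    have hθ0 := hθ.1
    have := (mul_le_mul_of_nonneg_right hge (norm_nonneg _)).trans (hC _ (hz1 θ))
    rw [le_div_iff₀ (by positivity)]
    rw [div_mul_eq_mul_div, div_le_iff₀ Real.pi_pos] at this
    linarith
  have hπ := Real.pi_gt_three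
  have hπ2 : Real.pi ≤ Real.pi ^ 2 := by nlinarith
  change ‖∫ θ in 0..Real.pi, (z θ * I) • (p.eval (z θ) • resolvent a (z θ))‖ ≤ _
  -- Since `R' = -R²`, differentiating `P R` gives `p R - P R²`; the factor `s` in `V` cancels the
  -- one from the parametrization. The constant `8π²` is dictated by the `P R²` term: `2 · 4 · π²`.
  refine (norm_integral_zero_pi_le_mul_log (A := 8 * Real.pi ^ 2 * M)
    (V := fun θ => (s : ℂ) • (P.eval (z θ) • resolvent a (z θ)))
    (S := fun θ => (z θ * I) • (P.eval (z θ) • resolvent a (z θ) ^ 2)) hh hC0 (by positivity)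
    (by fun_prop) (by fun_prop) (fun θ _ => ?_) (fun θ hθ => ?_) (fun θ hθ => ?_)
    fun θ hθ => ?_).trans_eq (by ring)
  · have h1 : HasDerivAt (fun w => P.eval w • resolvent a w)
        (P.eval (z θ) • (-resolvent a (z θ) ^ 2) + p.eval (z θ) • resolvent a (z θ)) (z θ) := by
      rw [← hP]
      exact (P.hasDerivAt (z θ)).smul
        (spectrum.hasDerivAt_resolvent_const_left (hσ _ (hz1 θ)))
    refine ((h1.scomp θ (hzd θ)).const_smul (s : ℂ)).congr_deriv ?_
    rw [smul_smul, ← mul_assoc, hss, one_mul, smul_add, smul_neg, smul_neg]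
    abel
  all_goals
    have hρ := hr θ hθ
    have hθ0 := hθ.1
    have hpos : 0 < h + θ := by linarith
    simp only [norm_smul, norm_mul, norm_I, mul_one, hzn]
  · calc (1 + h) * (‖p.eval (z θ)‖ * ‖resolvent a (z θ)‖)
        ≤ (1 + 1) * (M * (Real.pi * C / (h + θ))) := by
          gcongr
          exact hpM _ (hzn θ)
      _ = 2 * Real.pi * (M * C / (h + θ)) := by ring
      _ ≤ 8 * Real.pi ^ 2 * (M * C / (h + θ)) := by gcongr; norm_num
      _ = _ := by ring
  · rw [Complex.norm_real, Real.norm_eq_abs, hs, one_mul]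
    calc ‖P.eval (z θ)‖ * ‖resolvent a (z θ)‖
        ≤ (4 * M * h) * (Real.pi * C / (h + θ)) := by
          gcongr
          exact hPM _ (hzn θ)
      _ = 4 * Real.pi * (M * h * C / (h + θ)) := by ring
      _ ≤ 8 * Real.pi ^ 2 * (M * h * C / (h + θ)) := by gcongr; norm_num
      _ = _ := by ring
  · calc (1 + h) * (‖P.eval (z θ)‖ * ‖resolvent a (z θ) ^ 2‖)
        ≤ (1 + 1) * ((4 * M * h) * (Real.pi * C / (h + θ)) ^ 2) := by
          gcongr
          · exact hPM _ (hzn θ)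
          · exact (norm_pow_le' _ two_pos).trans (by gcongr)
      _ = _ := by rw [div_pow]; ring

/-- The functional calculus estimate for polynomials with coefficients in a dyadic block. -/
theorem norm_aeval_le_mul_log {C : ℝ} (hC0 : 1 / 2 ≤ C)
    (hσ : ∀ z : ℂ, 1 < ‖z‖ → z ∈ resolventSet ℂ a)
    (hC : ∀ z : ℂ, 1 < ‖z‖ → ‖z - 1‖ * ‖resolvent a z‖ ≤ C) {N m : ℕ} (hN : 1 ≤ N)
    (hm : N ≤ 2 * (m + 1)) {p : ℂ[X]} (hd : p.natDegree ≤ 2 * N) (hdvd : X ^ m ∣ p) {B : ℝ}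
    (hB : ∀ z : ℂ, ‖z‖ = 1 → ‖p.eval z‖ ≤ B) :
    ‖aeval a p‖ ≤ 432 * Real.pi * C * Real.log (C + 1) * B := by
  obtain ⟨P, hP, hP0⟩ := p.exists_derivative_eq_and_eval_zero
  obtain ⟨q, hq⟩ := hdvd
  have hB0 : 0 ≤ B := (norm_nonneg _).trans (hB 1 norm_one)
  have hN0 : (0 : ℝ) < N := by exact_mod_cast hN
  have hN1 : (1 : ℝ) ≤ N := by exact_mod_cast hN
  set h : ℝ := 1 / N with hh
  have hh0 : 0 < h := by positivity
  have hh1 : h ≤ 1 := by rw [hh, div_le_one hN0]; exact hN1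
  have hpM (z : ℂ) (hz : ‖z‖ = 1 + h) : ‖p.eval z‖ ≤ 9 * B := by
    refine (Polynomial.norm_eval_le_of_norm_eval_le_on_sphere hd one_pos hB (by linarith)).trans ?_
    -- Degree `2N` squares this factor, whence the `9`.
    have he : (1 + h) ^ N ≤ 3 := by
      have h1 : 1 + h ≤ Real.exp h := by linarith [Real.add_one_le_exp h]
      calc (1 + h) ^ N ≤ Real.exp h ^ N := by gcongr
        _ = Real.exp 1 := by rw [← Real.exp_nat_mul, hh, mul_one_div_cancel hN0.ne']
        _ ≤ 3 := Real.exp_one_lt_d9.le.trans (by norm_num)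
    rw [hz, div_one, mul_comm 2 N, pow_mul, mul_comm]
    gcongr
    calc ((1 + h) ^ N) ^ 2 ≤ 3 ^ 2 := by gcongr
      _ = 9 := by norm_num
  have hPM (z : ℂ) (hz : ‖z‖ = 1 + h) : ‖P.eval z‖ ≤ 4 * (9 * B) * h := by
    refine (Polynomial.norm_eval_le_of_derivative_norm_le (hP.trans hq) hP0 (by positivity)
      (B := 9 * B) (by rwa [hP]) hz).trans ?_
    have hm' : (N : ℝ) ≤ 2 * (m + 1) := by exact_mod_cast hm
    rw [div_le_iff₀ (by positivity)]
    have h1 : 1 ≤ h * (2 * (m + 1)) := by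
      rw [hh, one_div, inv_mul_eq_div, one_le_div hN0]
      exact hm'
    calc (1 + h) * (9 * B) ≤ 2 * (9 * B) * 1 := by
          rw [mul_one]
          gcongr
          linarith
      _ ≤ 2 * (9 * B) * (h * (2 * (m + 1))) := by gcongr
      _ = _ := by ring
  have hhalf {s : ℝ} (hs : |s| = 1) := norm_integral_zero_pi_resolvent_le (by linarith) hσ hC hh0
    hh1 (by positivity : 0 ≤ 9 * B) hP hpM hPM hs
  have hint := circleIntegral_eval_smul_resolvent hσ hC (R := 1 + h) (by linarith) p
  have hcI : CircleIntegrable (fun z => p.eval z • resolvent a z) 0 (1 + h) := by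
    refine ContinuousOn.circleIntegrable (by positivity) (p.continuous.continuousOn.smul
      (continuousOn_resolvent_of_forall_one_lt hσ fun z hz => ?_))
    rw [mem_sphere_zero_iff_norm.1 hz]
    linarith
  have hI := hcI.out
  set G : ℝ → A := fun θ => (circleMap 0 (1 + h) θ * I) •
      (p.eval (circleMap 0 (1 + h) θ) • resolvent a (circleMap 0 (1 + h) θ)) with hG
  have hI' : IntervalIntegrable G MeasureTheory.volume 0 (2 * Real.pi) := by
    simpa only [deriv_circleMap] using hI
  have hint' : ∫ θ in 0..(2 * Real.pi), G θ = (2 * Real.pi * I : ℂ) • aeval a p := by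
    rw [← hint]
    simp only [circleIntegral, deriv_circleMap, hG]
  have hπ := Real.pi_pos
  have hsub1 : Set.uIcc 0 Real.pi ⊆ Set.uIcc 0 (2 * Real.pi) := by
    rw [Set.uIcc_of_le hπ.le, Set.uIcc_of_le (by linarith)]
    exact Set.Icc_subset_Icc_right (by linarith)
  have hsub2 : Set.uIcc Real.pi (2 * Real.pi) ⊆ Set.uIcc 0 (2 * Real.pi) := by
    rw [Set.uIcc_of_le (by linarith), Set.uIcc_of_le (by linarith)]
    exact Set.Icc_subset_Icc_left hπ.le
  have hrefl : ∫ θ in Real.pi..(2 * Real.pi), G θ = ∫ θ in 0..Real.pi, G (-1 * θ) := by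
    have := intervalIntegral.integral_comp_sub_left (a := 0) (b := Real.pi) G (2 * Real.pi)
    rw [sub_zero, show 2 * Real.pi - Real.pi = Real.pi by ring] at this
    rw [← this]
    refine intervalIntegral.integral_congr fun θ _ => ?_
    have hper : circleMap 0 (1 + h) (2 * Real.pi - θ) = circleMap 0 (1 + h) (-1 * θ) := by
      rw [sub_eq_neg_add, periodic_circleMap, neg_one_mul]
    simp only [hG, hper]
  have h1 := hhalf (s := 1) (by simp)
  have h2 := hhalf (s := -1) (by simp)
  simp only [one_mul] at h1
  have h3 := norm_add_le (∫ θ in 0..Real.pi, G θ) (∫ θ in 0..Real.pi, G (-1 * θ))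
  rw [← hrefl, intervalIntegral.integral_add_adjacent_intervals (hI'.mono_set hsub1)
    (hI'.mono_set hsub2), hint', hrefl, norm_smul] at h3
  have hn : ‖(2 * Real.pi * I : ℂ)‖ = 2 * Real.pi := by
    simp [abs_of_pos hπ]
  rw [hn] at h3
  have hlog : 0 ≤ Real.log (1 + C) := Real.log_nonneg (by linarith)
  have h4 : 2 * Real.pi * ‖aeval a p‖ ≤
      2 * Real.pi * (432 * Real.pi * C * Real.log (C + 1) * B) := by
    calc _ ≤ 2 * (16 * Real.pi ^ 2 * (9 * B) * (C + 1) * Real.log (1 + C)) := by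
          linarith [h3.trans (add_le_add h1 h2)]
      -- The lower bound `C ≥ 1/2` is what allows `C + 1 ≤ 3C`.
      _ ≤ 2 * (16 * Real.pi ^ 2 * (9 * B) * (3 * C) * Real.log (1 + C)) := by
          gcongr
          linarith
      _ = _ := by rw [add_comm C 1]; ring
  exact le_of_mul_le_mul_left h4 (by positivity)

/-- The resolvent constant is bounded below. -/
theorem one_half_le_of_norm_resolvent_le [NormOneClass A] {C : ℝ}
    (hσ : ∀ z : ℂ, 1 < ‖z‖ → z ∈ resolventSet ℂ a)
    (hC : ∀ z : ℂ, 1 < ‖z‖ → ‖z - 1‖ * ‖resolvent a z‖ ≤ C) : 1 / 2 ≤ C := by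
  -- On `|z| = 2` one has `|z - 1| ≥ 1`, so the integral, of norm `2π`, is at most `4πC`.
  have h := circleIntegral_resolvent hσ hC one_lt_two
  have hle := circleIntegral.norm_integral_le_of_norm_le_const (f := resolvent a) (c := (0 : ℂ))
    zero_le_two (C := C) fun z hz => by
      rw [mem_sphere_zero_iff_norm] at hz
      refine le_trans ?_ (hC z (by rw [hz]; norm_num))
      have := norm_sub_norm_le z 1
      rw [hz, norm_one] at this
      exact le_mul_of_one_le_left (norm_nonneg _) (by linarith)
  have hn : ‖(2 * Real.pi * I : ℂ) • (1 : A)‖ = 2 * Real.pi := by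
    rw [norm_smul]
    simp [abs_of_pos Real.pi_pos]
  rw [h, hn] at hle
  have := Real.pi_pos
  by_contra hlt
  nlinarith

end Resolvent

/-! ### Maximum principle and Fejér means -/

open Polynomial in
/-- The maximum principle for polynomials. -/
theorem Polynomial.norm_eval_le_of_norm_le {p : ℂ[X]} {ρ B : ℝ} (hρ : 0 < ρ)
    (hB : ∀ z : ℂ, ‖z‖ = ρ → ‖p.eval z‖ ≤ B) {z : ℂ} (hz : ‖z‖ ≤ ρ) : ‖p.eval z‖ ≤ B := by
  refine Complex.norm_le_of_forall_mem_frontier_norm_le (f := fun w => p.eval w)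
    (U := Metric.ball (0 : ℂ) ρ) Metric.isBounded_ball
    (Polynomial.differentiable _).diffContOnCl (fun w hw => ?_) ?_
  · rw [frontier_ball _ hρ.ne', mem_sphere_zero_iff_norm] at hw
    exact hB w hw
  · rwa [closure_ball _ hρ.ne', mem_closedBall_zero_iff]

section Fejer

open Complex

theorem circleIntegral_div_pow_mul {g : ℂ → ℂ} {r : ℝ} (hr : 0 < r)
    (hg : DifferentiableOn ℂ g (Metric.closedBall 0 r)) {z : ℂ} (hz : z ≠ 0) (j l : ℕ) :
    ∮ w in C(0, r), w⁻¹ * ((z / w) ^ j * (w / z) ^ l) * g w =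
      2 * Real.pi * I *
        if l ≤ j then TadmorRitt.taylorCoeff g (j - l) * z ^ (j - l) else 0 := by
  have hne (w : ℂ) (hw : w ∈ Metric.sphere (0 : ℂ) r) : w ≠ 0 := by
    rintro rfl
    simp at hw
    linarith
  split_ifs with hjl
  · obtain ⟨k, rfl⟩ := Nat.exists_eq_add_of_le hjl
    have h := hg.circleIntegral_one_div_sub_center_pow_smul hr k
    simp only [sub_zero, smul_eq_mul] at h
    rw [Nat.add_sub_cancel_left]
    calc _ = ∮ w in C(0, r), z ^ k * (1 / w ^ (k + 1) * g w) := by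
          refine circleIntegral.integral_congr hr.le fun w hw => ?_
          have := hne w hw
          simp only [div_pow]
          field_simp
          ring
      _ = _ := by
          rw [circleIntegral.integral_const_mul, h, TadmorRitt.taylorCoeff]
          ring
  · obtain ⟨k, rfl⟩ := Nat.exists_eq_add_of_lt (not_le.1 hjl)
    rw [mul_zero]
    calc _ = ∮ w in C(0, r), (z ^ (k + 1))⁻¹ * (w ^ k * g w) := by
          refine circleIntegral.integral_congr hr.le fun w hw => ?_
          have := hne w hw
          simp only [div_pow]
          field_simp
          ring
      _ = 0 := by
          have : DifferentiableOn ℂ (fun w => w ^ k * g w) (Metric.closedBall 0 r) :=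
            (differentiableOn_id.pow k).mul hg
          rw [circleIntegral.integral_const_mul, DiffContOnCl.circleIntegral_eq_zero hr.le
            (this.mono Metric.closure_ball_subset_closedBall).diffContOnCl, mul_zero]

theorem sum_range_ite_sub_eq_sum_range_succ (c : ℕ → ℂ) {M j : ℕ} (hj : j < M) :
    ∑ l ∈ Finset.range M, (if l ≤ j then c (j - l) else 0) = ∑ k ∈ Finset.range (j + 1), c k := by
  rw [← Finset.sum_filter]
  have : (Finset.range M).filter (· ≤ j) = Finset.range (j + 1) := by
    ext l
    simp only [Finset.mem_filter, Finset.mem_range]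
    omega
  rw [this, ← Finset.sum_range_reflect c (j + 1)]
  exact Finset.sum_congr rfl fun l _ => by simp

/-- On `|w| = |z|` the conjugate of `z / w` is `w / z`, so the squared modulus expands into Laurent
monomials in `w`; the pair `(j, l)` extracts the Taylor term of index `j - l`, or nothing when `l >
j`. -/
theorem circleIntegral_fejer_mul {g : ℂ → ℂ} {r : ℝ} (hr : 0 < r)
    (hg : DifferentiableOn ℂ g (Metric.closedBall 0 r)) {z : ℂ} (hz : ‖z‖ = r) (M : ℕ) :
    ∮ w in C(0, r), w⁻¹ * ((‖∑ j ∈ Finset.range M, (z / w) ^ j‖ ^ 2 : ℝ) : ℂ) * g w =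
      2 * Real.pi * I * ∑ j ∈ Finset.range M, ∑ k ∈ Finset.range (j + 1),
        TadmorRitt.taylorCoeff g k * z ^ k := by
  have hz0 : z ≠ 0 := norm_pos_iff.1 (hz ▸ hr)
  have hne (w : ℂ) (hw : w ∈ Metric.sphere (0 : ℂ) r) : w ≠ 0 := by
    rintro rfl
    simp at hw
    linarith
  have hci (j l : ℕ) :
      CircleIntegrable (fun w => w⁻¹ * ((z / w) ^ j * (w / z) ^ l) * g w) 0 r := by
    refine ContinuousOn.circleIntegrable hr.le (ContinuousOn.mul (ContinuousOn.mul
      (continuousOn_id.inv₀ hne) (ContinuousOn.mul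
        ((continuousOn_const.div continuousOn_id hne).pow j)
        ((continuousOn_id.div_const z).pow l))) ?_)
    exact hg.continuousOn.mono Metric.sphere_subset_closedBall
  calc _ = ∮ w in C(0, r), ∑ j ∈ Finset.range M, ∑ l ∈ Finset.range M,
        w⁻¹ * ((z / w) ^ j * (w / z) ^ l) * g w := by
        refine circleIntegral.integral_congr hr.le fun w hw => ?_
        have hw0 := hne w hw
        rw [mem_sphere_zero_iff_norm] at hw
        have hconj : (starRingEnd ℂ) (z / w) = w / z := by
          have h1 : ‖z / w‖ = 1 := by rw [norm_div, hz, hw, div_self hr.ne']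
          rw [← Complex.inv_eq_conj h1, inv_div]
        rw [← Complex.normSq_eq_norm_sq, ← Complex.mul_conj, map_sum, Finset.sum_mul_sum,
          Finset.mul_sum, Finset.sum_mul]
        refine Finset.sum_congr rfl fun j _ => ?_
        rw [Finset.mul_sum, Finset.sum_mul]
        refine Finset.sum_congr rfl fun l _ => ?_
        rw [map_pow, hconj]
    _ = ∑ j ∈ Finset.range M, ∑ l ∈ Finset.range M,
        ∮ w in C(0, r), w⁻¹ * ((z / w) ^ j * (w / z) ^ l) * g w := by
        rw [circleIntegral.integral_fun_sum fun j _ =>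
          CircleIntegrable.fun_sum _ fun l _ => hci j l]
        exact Finset.sum_congr rfl fun j _ => circleIntegral.integral_fun_sum fun l _ => hci j l
    _ = _ := by
        simp only [circleIntegral_div_pow_mul hr hg hz0, ← Finset.mul_sum]
        congr 1
        exact Finset.sum_congr rfl fun j hj => sum_range_ite_sub_eq_sum_range_succ
          (fun k => TadmorRitt.taylorCoeff g k * z ^ k) (Finset.mem_range.1 hj)

theorem circleIntegral_inv_mul_eq {r : ℝ} (hr : 0 < r) (F : ℂ → ℂ) :
    ∮ w in C(0, r), w⁻¹ * F w = I * ∫ θ in 0..(2 * Real.pi), F (circleMap 0 r θ) := by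
  rw [circleIntegral, ← intervalIntegral.integral_const_mul]
  refine intervalIntegral.integral_congr fun θ _ => ?_
  have : circleMap 0 r θ ≠ 0 := circleMap_ne_center hr.ne'
  simp only [deriv_circleMap, smul_eq_mul]
  field_simp

/-- Fejér means do not increase the supremum norm on a circle. -/
theorem norm_sum_partial_sums_le {g : ℂ → ℂ} {r B : ℝ} (hr : 0 < r)
    (hg : DifferentiableOn ℂ g (Metric.closedBall 0 r)) (hB : ∀ w : ℂ, ‖w‖ = r → ‖g w‖ ≤ B)
    {z : ℂ} (hz : ‖z‖ = r) (M : ℕ) :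
    ‖∑ j ∈ Finset.range M, ∑ k ∈ Finset.range (j + 1),
      TadmorRitt.taylorCoeff g k * z ^ k‖ ≤ M * B := by
  set K : ℝ → ℝ := fun θ => ‖∑ j ∈ Finset.range M, (z / circleMap 0 r θ) ^ j‖ ^ 2 with hK
  have hKc : Continuous K := by
    have : ∀ θ, circleMap 0 r θ ≠ 0 := fun θ => circleMap_ne_center hr.ne'
    refine (Continuous.norm (continuous_finsetSum _ fun j _ => ?_)).pow 2
    exact (continuous_const.div (continuous_circleMap 0 r) this).pow j
  have hπ := Real.pi_pos
  -- The constant function reveals the total mass `2πM` of the nonnegative kernel.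
  have h1 := circleIntegral_fejer_mul hr (g := fun _ => 1) (differentiableOn_const 1) hz M
  have hone : ∑ j ∈ Finset.range M, ∑ k ∈ Finset.range (j + 1),
      TadmorRitt.taylorCoeff (fun _ => 1) k * z ^ k = M := by
    have (j : ℕ) : ∑ k ∈ Finset.range (j + 1),
        TadmorRitt.taylorCoeff (fun _ => 1) k * z ^ k = 1 := by
      rw [Finset.sum_eq_single_of_mem 0 (by simp)]
      · simp [TadmorRitt.taylorCoeff]
      · intro k _ hk
        simp [TadmorRitt.taylorCoeff, iteratedDeriv_const, hk]
    simp [this]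
  have hg' := circleIntegral_fejer_mul hr hg hz M
  simp only [mul_assoc (_⁻¹ : ℂ)] at h1 hg'
  rw [circleIntegral_inv_mul_eq hr] at h1 hg'
  have hmass : ∫ θ in 0..(2 * Real.pi), K θ = 2 * Real.pi * M := by
    rw [hone] at h1
    have h2 : (∫ θ in 0..(2 * Real.pi), ((K θ : ℝ) : ℂ)) = 2 * Real.pi * M := by
      refine mul_left_cancel₀ I_ne_zero ?_
      simp only [mul_one] at h1
      rw [h1]
      ring
    rw [intervalIntegral.integral_ofReal] at h2
    exact_mod_cast h2
  have hle : ‖∫ θ in 0..(2 * Real.pi), ((K θ : ℝ) : ℂ) * g (circleMap 0 r θ)‖ ≤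
      2 * Real.pi * M * B := by
    rw [← hmass, ← intervalIntegral.integral_mul_const]
    refine intervalIntegral.norm_integral_le_of_norm_le (by positivity)
      (.of_forall fun θ _ => ?_) ((hKc.mul continuous_const).intervalIntegrable _ _)
    rw [norm_mul, Complex.norm_real, Real.norm_of_nonneg (sq_nonneg _)]
    gcongr
    exact hB _ (by rw [norm_circleMap_zero, abs_of_pos hr])
  have hn := congrArg norm hg'
  rw [norm_mul, norm_mul, norm_I, one_mul] at hn
  have hn2 : ‖(2 * Real.pi * I : ℂ)‖ = 2 * Real.pi := by simp [abs_of_pos hπ]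
  rw [hn2] at hn
  have : 2 * Real.pi * ‖∑ j ∈ Finset.range M, ∑ k ∈ Finset.range (j + 1),
      TadmorRitt.taylorCoeff g k * z ^ k‖ ≤ 2 * Real.pi * (M * B) := by
    rw [← hn, ← mul_assoc]
    exact hle
  exact le_of_mul_le_mul_left this (by positivity)

theorem sum_partial_sums_eq (c : ℕ → ℂ) {M L : ℕ} (hML : M ≤ L) :
    ∑ j ∈ Finset.range M, ∑ k ∈ Finset.range (j + 1), c k =
      ∑ k ∈ Finset.range L, ((M - k : ℕ) : ℂ) * c k := by
  induction M with
  | zero => simp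
  | succ M ih =>
    rw [Finset.sum_range_succ, ih (by omega)]
    have : ∑ k ∈ Finset.range (M + 1), c k =
        ∑ k ∈ Finset.range L, if k < M + 1 then c k else 0 := by
      rw [← Finset.sum_filter]
      congr 1
      ext k
      simp only [Finset.mem_filter, Finset.mem_range]
      omega
    rw [this, ← Finset.sum_add_distrib]
    refine Finset.sum_congr rfl fun k _ => ?_
    split_ifs with hk
    · rw [show M + 1 - k = (M - k) + 1 by omega]
      push_cast
      ring
    · rw [show M + 1 - k = 0 by omega, show M - k = 0 by omega]
      simp

theorem norm_sum_tsub_mul_taylorCoeff_le {g : ℂ → ℂ} {r B : ℝ} (hr : 0 < r)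
    (hg : DifferentiableOn ℂ g (Metric.closedBall 0 r)) (hB : ∀ w : ℂ, ‖w‖ = r → ‖g w‖ ≤ B)
    {z : ℂ} (hz : ‖z‖ = r) {M L : ℕ} (hML : M ≤ L) :
    ‖∑ k ∈ Finset.range L, ((M - k : ℕ) : ℂ) * (TadmorRitt.taylorCoeff g k * z ^ k)‖ ≤ M * B := by
  rw [← sum_partial_sums_eq _ hML]
  exact norm_sum_partial_sums_le hr hg hB hz M

end Fejer

/-! ### Dyadic blocks and their derivatives -/

namespace TadmorRitt

open Polynomial

theorem coeff_conv (g : ℂ[X]) (f : ℂ → ℂ) (k : ℕ) :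
    (conv g f).coeff k = g.coeff k * taylorCoeff f k := by
  rw [conv, Polynomial.sum, finsetSum_coeff]
  simp only [coeff_monomial, Finset.sum_ite_eq', mem_support_iff, ne_eq, ite_not]
  split_ifs with h
  · rw [h, zero_mul]
  · rfl

theorem triangle_succ (n : ℕ) (x : ℝ) : triangle (n + 1) x =
    max 0 (min ((x - 2 ^ n) / 2 ^ n) ((4 * 2 ^ n - x) / (2 * 2 ^ n))) := by
  rw [triangle]
  have h1 : ((n + 1 : ℕ) : ℤ) - 1 = n := by push_cast; ring
  have h2 : ((n + 1 : ℕ) : ℤ) + 1 = ((n + 2 : ℕ) : ℤ) := by push_cast; ring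
  rw [h1, h2, zpow_natCast, zpow_natCast, zpow_natCast, pow_add, pow_succ]
  ring_nf

/-- The dyadic triangle as a combination of three Fejér triangles. -/
theorem triangle_succ_natCast_succ (n k : ℕ) : triangle (n + 1) ((k + 1 : ℕ) : ℝ) =
    (((4 * 2 ^ n - 1 - k : ℕ) : ℝ) - 3 * ((2 * 2 ^ n - 1 - k : ℕ) : ℝ) +
      2 * ((2 ^ n - 1 - k : ℕ) : ℝ)) / (2 * 2 ^ n) := by
  rw [triangle_succ]
  have hH : 0 < 2 ^ n := by positivity
  have hcast : ((2 ^ n : ℕ) : ℝ) = 2 ^ n := by push_cast; rfl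
  rw [← hcast]
  generalize 2 ^ n = H at hH
  have hH' : (0 : ℝ) < H := by exact_mod_cast hH
  -- Truncated subtraction plays the positive part; the cases are cut at the kinks `H`, `2H`, `4H`
  -- of the triangle.
  rcases lt_or_ge k H with h1 | h1
  · have e1 : ((4 * H - 1 - k : ℕ) : ℝ) = 4 * H - 1 - k := by
      rw [Nat.sub_sub, Nat.cast_sub (by omega)]; push_cast; ring
    have e2 : ((2 * H - 1 - k : ℕ) : ℝ) = 2 * H - 1 - k := by
      rw [Nat.sub_sub, Nat.cast_sub (by omega)]; push_cast; ring
    have e3 : ((H - 1 - k : ℕ) : ℝ) = H - 1 - k := by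
      rw [Nat.sub_sub, Nat.cast_sub (by omega)]; push_cast; ring
    rw [e1, e2, e3, max_eq_left]
    · ring
    · refine min_le_of_left_le (div_nonpos_of_nonpos_of_nonneg ?_ hH'.le)
      have : ((k + 1 : ℕ) : ℝ) ≤ H := by exact_mod_cast h1
      linarith
  have e3 : H - 1 - k = 0 := by omega
  have h1' : (H : ℝ) ≤ k := by exact_mod_cast h1
  rcases lt_or_ge k (2 * H) with h2 | h2
  · have e1 : ((4 * H - 1 - k : ℕ) : ℝ) = 4 * H - 1 - k := by
      rw [Nat.sub_sub, Nat.cast_sub (by omega)]; push_cast; ring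
    have e2 : ((2 * H - 1 - k : ℕ) : ℝ) = 2 * H - 1 - k := by
      rw [Nat.sub_sub, Nat.cast_sub (by omega)]; push_cast; ring
    have h2' : (k : ℝ) + 1 ≤ 2 * H := by exact_mod_cast h2
    rw [e1, e2, e3, min_eq_left, max_eq_right]
    · push_cast
      field_simp
      ring
    · push_cast
      exact div_nonneg (by linarith) hH'.le
    · push_cast
      rw [div_le_div_iff₀ (by positivity) (by positivity)]
      nlinarith
  have e2 : 2 * H - 1 - k = 0 := by omega
  have h2' : (2 * H : ℝ) ≤ k := by exact_mod_cast h2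
  rcases lt_or_ge k (4 * H) with h4 | h4
  · have e1 : ((4 * H - 1 - k : ℕ) : ℝ) = 4 * H - 1 - k := by
      rw [Nat.sub_sub, Nat.cast_sub (by omega)]; push_cast; ring
    have h4' : (k : ℝ) + 1 ≤ 4 * H := by exact_mod_cast h4
    rw [e1, e2, e3, min_eq_right, max_eq_right]
    · push_cast
      ring
    · push_cast
      exact div_nonneg (by linarith) (by positivity)
    · push_cast
      rw [div_le_div_iff₀ (by positivity) (by positivity)]
      nlinarith
  · have e1 : 4 * H - 1 - k = 0 := by omega
    have h4' : (4 * H : ℝ) ≤ k := by exact_mod_cast h4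
    rw [e1, e2, e3, max_eq_left]
    · simp
    · refine min_le_of_right_le (div_nonpos_of_nonpos_of_nonneg ?_ (by positivity))
      push_cast
      linarith

theorem triangle_eq_zero_of_le {n k : ℕ} (hk : k ≤ 2 ^ n) : triangle (n + 1) (k : ℝ) = 0 := by
  have : (k : ℝ) ≤ 2 ^ n := by exact_mod_cast hk
  rw [triangle_succ]
  exact max_eq_left
    (min_le_of_left_le (div_nonpos_of_nonpos_of_nonneg (by linarith) (by positivity)))

theorem triangle_eq_zero_of_ge {n k : ℕ} (hk : 4 * 2 ^ n ≤ k) : triangle (n + 1) (k : ℝ) = 0 := by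
  have : (4 * 2 ^ n : ℝ) ≤ k := by exact_mod_cast hk
  rw [triangle_succ]
  exact max_eq_left
    (min_le_of_right_le (div_nonpos_of_nonpos_of_nonneg (by linarith) (by positivity)))

theorem coeff_W_succ (n k : ℕ) : (W (n + 1)).coeff k = ((triangle (n + 1) (k : ℝ) : ℝ) : ℂ) := by
  rw [W, if_neg n.succ_ne_zero, finsetSum_coeff]
  simp only [coeff_monomial, Finset.sum_ite_eq', Finset.mem_range]
  split_ifs with h
  · rfl
  · rw [triangle_eq_zero_of_ge, Complex.ofReal_zero]
    rw [pow_add, pow_succ] at h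
    omega

theorem natDegree_conv_W_zero_le (f : ℂ → ℂ) : (conv (W 0) f).natDegree ≤ 2 * 2 ^ 0 := by
  rw [natDegree_le_iff_coeff_eq_zero]
  intro k hk
  rw [coeff_conv, W, if_pos rfl, coeff_add, coeff_one, coeff_X, if_neg (by omega),
    if_neg (by omega), add_zero, zero_mul]

theorem natDegree_conv_W_succ_le (n : ℕ) (f : ℂ → ℂ) :
    (conv (W (n + 1)) f).natDegree ≤ 4 * 2 ^ n := by
  rw [natDegree_le_iff_coeff_eq_zero]
  intro k hk
  rw [coeff_conv, coeff_W_succ, triangle_eq_zero_of_ge hk.le, Complex.ofReal_zero, zero_mul]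

theorem X_pow_dvd_conv_W_succ (n : ℕ) (f : ℂ → ℂ) : X ^ 2 ^ n ∣ conv (W (n + 1)) f := by
  rw [X_pow_dvd_iff]
  intro k hk
  rw [coeff_conv, coeff_W_succ, triangle_eq_zero_of_le hk.le, Complex.ofReal_zero, zero_mul]

theorem taylorCoeff_deriv (f : ℂ → ℂ) (k : ℕ) :
    taylorCoeff (deriv f) k = (k + 1) * taylorCoeff f (k + 1) := by
  rw [taylorCoeff, taylorCoeff, iteratedDeriv_succ', Nat.factorial_succ]
  have h1 : (k : ℂ) + 1 ≠ 0 := by exact_mod_cast k.succ_ne_zero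
  have h2 : (k.factorial : ℂ) ≠ 0 := by exact_mod_cast k.factorial_ne_zero
  push_cast
  field_simp

theorem coeff_derivative_conv_W_succ (n : ℕ) (f : ℂ → ℂ) (k : ℕ) :
    (derivative (conv (W (n + 1)) f)).coeff k =
      ((triangle (n + 1) ((k + 1 : ℕ) : ℝ) : ℝ) : ℂ) * taylorCoeff (deriv f) k := by
  rw [coeff_derivative, coeff_conv, coeff_W_succ, taylorCoeff_deriv]
  ring

/-- The three Fejér sums contribute `4 + 3 · 2 + 2 · 1 = 12` multiples of `2 ^ n B`, divided by `2 ·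
2 ^ n`. -/
theorem norm_eval_derivative_conv_W_succ_le {f : ℂ → ℂ} {r B : ℝ} (hr : 0 < r)
    (hf : DifferentiableOn ℂ (deriv f) (Metric.closedBall 0 r))
    (hB : ∀ w : ℂ, ‖w‖ = r → ‖deriv f w‖ ≤ B) (n : ℕ) {z : ℂ} (hz : ‖z‖ = r) :
    ‖(derivative (conv (W (n + 1)) f)).eval z‖ ≤ 6 * B := by
  have hdeg : (derivative (conv (W (n + 1)) f)).natDegree < 4 * 2 ^ n := by
    have h1 := natDegree_conv_W_succ_le n f
    have h2 := natDegree_derivative_le (conv (W (n + 1)) f)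
    have h3 : 0 < 2 ^ n := by positivity
    omega
  have hB0 : 0 ≤ B := (norm_nonneg _).trans (hB z hz)
  have hH : 0 < 2 ^ n := by positivity
  rw [eval_eq_sum_range' hdeg]
  have key {M : ℕ} (hM : M ≤ 4 * 2 ^ n) := norm_sum_tsub_mul_taylorCoeff_le hr hf hB hz hM
  have k1 := key (M := 4 * 2 ^ n - 1) (by omega)
  have k2 := key (M := 2 * 2 ^ n - 1) (by omega)
  have k3 := key (M := 2 ^ n - 1) (by omega)
  simp only [coeff_derivative_conv_W_succ, triangle_succ_natCast_succ]
  have hsum : ∑ k ∈ Finset.range (4 * 2 ^ n),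
      (((((4 * 2 ^ n - 1 - k : ℕ) : ℝ) - 3 * ((2 * 2 ^ n - 1 - k : ℕ) : ℝ) +
        2 * ((2 ^ n - 1 - k : ℕ) : ℝ)) / (2 * 2 ^ n) : ℝ) : ℂ) * taylorCoeff (deriv f) k * z ^ k =
      ((∑ k ∈ Finset.range (4 * 2 ^ n),
          ((4 * 2 ^ n - 1 - k : ℕ) : ℂ) * (taylorCoeff (deriv f) k * z ^ k)) -
        3 * (∑ k ∈ Finset.range (4 * 2 ^ n),
          ((2 * 2 ^ n - 1 - k : ℕ) : ℂ) * (taylorCoeff (deriv f) k * z ^ k)) +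
        2 * (∑ k ∈ Finset.range (4 * 2 ^ n),
          ((2 ^ n - 1 - k : ℕ) : ℂ) * (taylorCoeff (deriv f) k * z ^ k))) / (2 * 2 ^ n) := by
    rw [Finset.mul_sum, Finset.mul_sum, ← Finset.sum_sub_distrib, ← Finset.sum_add_distrib,
      Finset.sum_div]
    refine Finset.sum_congr rfl fun k _ => ?_
    push_cast
    ring
  rw [hsum, norm_div]
  have hn : ‖(2 * 2 ^ n : ℂ)‖ = 2 * 2 ^ n := by simp
  rw [hn, div_le_iff₀ (by positivity)]
  refine (norm_add_le _ _).trans ?_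
  refine (add_le_add_left (norm_sub_le _ _) _).trans ?_
  rw [norm_mul, norm_mul, Complex.norm_ofNat, Complex.norm_ofNat]
  have c1 : ((4 * 2 ^ n - 1 : ℕ) : ℝ) * B ≤ 4 * 2 ^ n * B := by
    gcongr
    exact_mod_cast Nat.sub_le _ _
  have c2 : ((2 * 2 ^ n - 1 : ℕ) : ℝ) * B ≤ 2 * 2 ^ n * B := by
    gcongr
    exact_mod_cast Nat.sub_le _ _
  have c3 : ((2 ^ n - 1 : ℕ) : ℝ) * B ≤ 2 ^ n * B := by
    gcongr
    exact_mod_cast Nat.sub_le _ _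
  linarith

/-- A dyadic block of `f` on the unit disc is controlled by `f'` on a circle of radius close
to `1`. -/
theorem norm_eval_conv_W_succ_le {f : ℂ → ℂ} {r B : ℝ}
    (hf : DifferentiableOn ℂ (deriv f) (Metric.closedBall 0 r))
    (hB : ∀ w : ℂ, ‖w‖ = r → ‖deriv f w‖ ≤ B) {n : ℕ} (hr : 1 - 1 / (2 * 2 ^ n) ≤ r)
    (hr1 : r ≤ 1) {z : ℂ} (hz : ‖z‖ ≤ 1) :
    ‖(conv (W (n + 1)) f).eval z‖ ≤ 100 / 2 ^ n * B := by
  have hH : (1 : ℝ) ≤ 2 ^ n := one_le_pow₀ one_le_two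
  have hsmall : 1 / (2 * 2 ^ n) ≤ (1 / 2 : ℝ) := by
    rw [div_le_div_iff₀ (by positivity) (by positivity)]
    linarith
  have hr0 : 0 < r := by linarith
  have hB0 : 0 ≤ B := (norm_nonneg _).trans (hB r (by simp [abs_of_pos hr0]))
  set Q := conv (W (n + 1)) f with hQ
  have hdeg : (derivative Q).natDegree ≤ 4 * 2 ^ n :=
    (natDegree_derivative_le _).trans ((Nat.sub_le _ _).trans (natDegree_conv_W_succ_le n f))
  -- Bernoulli's inequality; with degree at most `4 · 2 ^ n`, passing from radius `r` to `1` then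
  -- costs at most `2 ^ 4`.
  have hhalf : (1 / 2 : ℝ) ≤ r ^ 2 ^ n := by
    have h1 := one_add_mul_le_pow (a := -(1 / (2 * 2 ^ n) : ℝ)) (by linarith) (2 ^ n)
    have h2 : 1 + ((2 ^ n : ℕ) : ℝ) * -(1 / (2 * 2 ^ n)) = 1 / 2 := by
      push_cast
      field_simp
      norm_num
    rw [h2] at h1
    refine h1.trans (pow_le_pow_left₀ (by linarith) (by linarith) _)
  have hgrow (w : ℂ) (hw : ‖w‖ = 1) : ‖(derivative Q).eval w‖ ≤ 96 * B := by
    refine (Polynomial.norm_eval_le_of_norm_eval_le_on_sphere hdeg hr0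
      (fun z hz => norm_eval_derivative_conv_W_succ_le hr0 hf hB n hz) (by linarith)).trans ?_
    have h16 : (1 / r) ^ (4 * 2 ^ n) ≤ 16 := by
      rw [mul_comm, pow_mul, one_div, inv_pow]
      calc ((r ^ 2 ^ n)⁻¹) ^ 4 ≤ ((1 / 2 : ℝ)⁻¹) ^ 4 := by gcongr
        _ = 16 := by norm_num
    rw [hw]
    calc 6 * B * (1 / r) ^ (4 * 2 ^ n) ≤ 6 * B * 16 := by gcongr
      _ = _ := by ring
  have hdvd : X ^ 2 ^ n ∣ derivative Q := by
    rw [X_pow_dvd_iff]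
    intro k hk
    rw [coeff_derivative_conv_W_succ, triangle_eq_zero_of_le hk, Complex.ofReal_zero, zero_mul]
  obtain ⟨q, hq⟩ := hdvd
  have hQ0 : Q.eval 0 = 0 := by
    rw [← coeff_zero_eq_eval_zero, coeff_conv, coeff_W_succ, triangle_eq_zero_of_le (Nat.zero_le _),
      Complex.ofReal_zero, zero_mul]
  refine Polynomial.norm_eval_le_of_norm_le one_pos (fun w hw => ?_) hz
  refine (Polynomial.norm_eval_le_of_derivative_norm_le hq hQ0 one_pos hgrow hw).trans ?_
  rw [one_mul, div_mul_eq_mul_div]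
  push_cast
  gcongr <;> linarith

/-! ### Summability of the blocks and conclusion -/

open MeasureTheory

theorem supNorm_conv_W_succ_le {f : ℂ → ℂ} (hf : DifferentiableOn ℂ f (Metric.ball 0 1)) {n : ℕ}
    {r : ℝ} (hr : 1 - 1 / (2 * 2 ^ n) ≤ r) (hr1 : r < 1) :
    supNorm (fun z => (conv (W (n + 1)) f).eval z) ≤ ENNReal.ofReal (100 / 2 ^ n) *
      ⨆ α : ℝ, ‖deriv f ((r : ℂ) * Complex.exp ((α : ℂ) * Complex.I))‖ₑ := by
  set M := ⨆ α : ℝ, ‖deriv f ((r : ℂ) * Complex.exp ((α : ℂ) * Complex.I))‖ₑ with hM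
  rcases eq_or_ne M ⊤ with htop | htop
  · rw [htop, ENNReal.mul_top]
    · exact le_top
    · exact (ENNReal.ofReal_pos.2 (by positivity)).ne'
  have hf' : DifferentiableOn ℂ (deriv f) (Metric.closedBall 0 r) :=
    (hf.deriv Metric.isOpen_ball).mono (Metric.closedBall_subset_ball hr1)
  have hB (w : ℂ) (hw : ‖w‖ = r) : ‖deriv f w‖ ≤ M.toReal := by
    rw [← ENNReal.ofReal_le_iff_le_toReal htop, ofReal_norm]
    have hpolar : (r : ℂ) * Complex.exp ((Complex.arg w : ℂ) * Complex.I) = w := by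
      rw [← hw, Complex.norm_mul_exp_arg_mul_I]
    rw [hM, ← hpolar]
    exact le_iSup (fun α : ℝ => ‖deriv f ((r : ℂ) * Complex.exp ((α : ℂ) * Complex.I))‖ₑ) _
  refine iSup₂_le fun z hz => ?_
  rw [← ofReal_norm, ← ENNReal.ofReal_toReal htop, ← ENNReal.ofReal_mul (by positivity)]
  exact ENNReal.ofReal_le_ofReal
    (norm_eval_conv_W_succ_le hf' hB hr hr1.le (mem_ball_zero_iff.1 hz).le)

theorem supNorm_eval_lt_top (p : ℂ[X]) : supNorm (fun z => p.eval z) < ⊤ := by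
  obtain ⟨B, hB⟩ := (isCompact_closedBall (0 : ℂ) 1).exists_bound_of_continuousOn
    p.continuous.continuousOn
  refine lt_of_le_of_lt (iSup₂_le fun z hz => ?_) (ENNReal.ofReal_lt_top (r := B))
  rw [← ofReal_norm]
  exact ENNReal.ofReal_le_ofReal (hB z (Metric.ball_subset_closedBall hz))

theorem norm_eval_le_toReal_supNorm (p : ℂ[X]) {z : ℂ} (hz : ‖z‖ = 1) :
    ‖p.eval z‖ ≤ (supNorm fun z => p.eval z).toReal := by
  have hcl : z ∈ closure (Metric.ball (0 : ℂ) 1) := by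
    rw [closure_ball _ one_ne_zero, mem_closedBall_zero_iff, hz]
  refine closure_minimal (t := {w | ‖p.eval w‖ ≤ (supNorm fun z => p.eval z).toReal})
    (fun w hw => ?_) (isClosed_le p.continuous.norm continuous_const) hcl
  rw [Set.mem_ofPred_eq, ← ENNReal.ofReal_le_iff_le_toReal (supNorm_eval_lt_top p).ne,
    ofReal_norm]
  exact le_iSup₂ (f := fun z (_ : z ∈ Metric.ball (0 : ℂ) 1) => ‖p.eval z‖ₑ) w hw

/-- The circle bound is averaged over an interval of radii of length `1 / (4 · 2 ^ n)`, which
cancels the decay `100 / 2 ^ n` and leaves `400`. -/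
theorem supNorm_conv_W_succ_le_lintegral {f : ℂ → ℂ}
    (hf : DifferentiableOn ℂ f (Metric.ball 0 1)) (n : ℕ) :
    supNorm (fun z => (conv (W (n + 1)) f).eval z) ≤
      400 * ∫⁻ r in Set.Ioo (1 - 1 / (2 * 2 ^ n) : ℝ) (1 - 1 / (2 * 2 ^ (n + 1))),
        ⨆ α : ℝ, ‖deriv f ((r : ℂ) * Complex.exp ((α : ℂ) * Complex.I))‖ₑ := by
  have hlen : (1 - 1 / (2 * 2 ^ (n + 1)) - (1 - 1 / (2 * 2 ^ n)) : ℝ) = 1 / (4 * 2 ^ n) := by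
    rw [pow_succ]
    field_simp
    ring
  have hlt : (1 - 1 / (2 * 2 ^ (n + 1)) : ℝ) < 1 := by
    have : (0 : ℝ) < 1 / (2 * 2 ^ (n + 1)) := by positivity
    linarith
  have hint := setLIntegral_mono' (μ := volume) measurableSet_Ioo fun r
    (hr : r ∈ Set.Ioo (1 - 1 / (2 * 2 ^ n) : ℝ) (1 - 1 / (2 * 2 ^ (n + 1)))) =>
    supNorm_conv_W_succ_le hf hr.1.le (hr.2.trans hlt)
  rw [setLIntegral_const, Real.volume_Ioo, hlen,
    -- Finiteness of the constant is used here in place of measurability of the circle maximum.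
    lintegral_const_mul' _ _ ENNReal.ofReal_ne_top] at hint
  have hone : ENNReal.ofReal (1 / (4 * 2 ^ n)) * ENNReal.ofReal (4 * 2 ^ n) = 1 := by
    rw [← ENNReal.ofReal_mul (by positivity), one_div_mul_cancel (by positivity),
      ENNReal.ofReal_one]
  have h400 : ENNReal.ofReal (4 * 2 ^ n) * ENNReal.ofReal (100 / 2 ^ n) = 400 := by
    rw [← ENNReal.ofReal_mul (by positivity)]
    have : (4 * 2 ^ n * (100 / 2 ^ n) : ℝ) = 400 := by
      field_simp
      norm_num
    rw [this, ENNReal.ofReal_ofNat]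
  calc supNorm (fun z => (conv (W (n + 1)) f).eval z)
      = ENNReal.ofReal (4 * 2 ^ n) * (supNorm (fun z => (conv (W (n + 1)) f).eval z) *
        ENNReal.ofReal (1 / (4 * 2 ^ n))) := by
        rw [mul_comm, mul_assoc, hone, mul_one]
    _ ≤ _ := mul_le_mul_right hint _
    _ = _ := by rw [← mul_assoc, h400]

theorem tsum_setLIntegral_dyadic_le (M : ℝ → ENNReal) :
    ∑' n : ℕ, ∫⁻ r in Set.Ioo (1 - 1 / (2 * 2 ^ n) : ℝ) (1 - 1 / (2 * 2 ^ (n + 1))), M r ≤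
      ∫⁻ r in Set.Ioo (0 : ℝ) 1, M r := by
  have hmono : Monotone fun n : ℕ => (1 - 1 / (2 * 2 ^ n) : ℝ) := fun m n hmn => by
    have : (2 : ℝ) ^ m ≤ 2 ^ n := pow_le_pow_right₀ one_le_two hmn
    dsimp only
    gcongr
  have hdisj : Pairwise (Function.onFun Disjoint fun n : ℕ =>
      Set.Ioo (1 - 1 / (2 * 2 ^ n) : ℝ) (1 - 1 / (2 * 2 ^ (n + 1)))) :=
    hmono.pairwise_disjoint_on_Ioo_succ
  rw [← lintegral_iUnion (fun _ => measurableSet_Ioo) hdisj]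
  refine lintegral_mono_set (Set.iUnion_subset fun n => Set.Ioo_subset_Ioo ?_ ?_)
  · have h0 := hmono (Nat.zero_le n)
    norm_num at h0 ⊢
    linarith
  · have : (0 : ℝ) < 1 / (2 * 2 ^ (n + 1)) := by positivity
    linarith

theorem starNorm_lt_top {f : ℂ → ℂ} (hf : MemBesov f) : starNorm f < ⊤ := by
  have hfin := hf.2
  rw [besovNorm] at hfin
  rw [starNorm, tsum_eq_zero_add' ENNReal.summable]
  refine ENNReal.add_lt_top.2 ⟨supNorm_eval_lt_top _, ?_⟩
  refine lt_of_le_of_lt (ENNReal.tsum_le_tsum (supNorm_conv_W_succ_le_lintegral hf.1)) ?_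
  rw [ENNReal.tsum_mul_left]
  exact ENNReal.mul_lt_top (by simp)
    ((tsum_setLIntegral_dyadic_le _).trans_lt (ENNReal.add_lt_top.1 hfin).2)

theorem norm_aeval_conv_W_le {X : Type*} [NormedAddCommGroup X] [NormedSpace ℂ X]
    [CompleteSpace X] {T : X →L[ℂ] X} (hT : IsTadmorRitt T) (f : ℂ → ℂ) (n : ℕ) :
    ‖aeval T (conv (W n) f)‖ ≤ 432 * Real.pi * rittConst T * Real.log (rittConst T + 1) *
      (supNorm fun z => (conv (W n) f).eval z).toReal := by
  have hσ (z : ℂ) (hz : 1 < ‖z‖) : z ∈ resolventSet ℂ T := by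
    by_contra h
    have := mem_closedBall_zero_iff.1 (hT.1 h)
    linarith
  have hC (z : ℂ) (hz : 1 < ‖z‖) : ‖z - 1‖ * ‖resolvent T z‖ ≤ rittConst T := by
    rw [← norm_smul]
    exact le_ciSup hT.2 ⟨z, hz⟩
  -- On the zero space `C(T) = 0`, so the lower bound `1/2` fails, but both sides vanish.
  rcases subsingleton_or_nontrivial X with hX | hX
  · have hT0 : rittConst T = 0 := by simp [rittConst, Subsingleton.elim _ (0 : X →L[ℂ] X)]
    rw [Subsingleton.elim (aeval T (conv (W n) f)) 0, hT0]
    simp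
  have hC2 := one_half_le_of_norm_resolvent_le hσ hC
  have hB (z : ℂ) (hz : ‖z‖ = 1) := norm_eval_le_toReal_supNorm (conv (W n) f) hz
  cases n with
  | zero =>
    exact norm_aeval_le_mul_log hC2 hσ hC (N := 2 ^ 0) (m := 0) (by simp) (by simp)
      (natDegree_conv_W_zero_le f) (by simp) hB
  | succ n =>
    refine norm_aeval_le_mul_log hC2 hσ hC (N := 2 ^ (n + 1)) (m := 2 ^ n)
      Nat.one_le_two_pow (by rw [pow_succ]; omega) ?_ (X_pow_dvd_conv_W_succ n f) hB
    refine (natDegree_conv_W_succ_le n f).trans ?_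
    rw [pow_succ]
    omega

end TadmorRitt

theorem theorem4 :
    ∃ a : ℝ, 0 < a ∧
      ∀ (X : Type*) [NormedAddCommGroup X] [NormedSpace ℂ X] [CompleteSpace X] (T : X →L[ℂ] X),
        TadmorRitt.IsTadmorRitt T →
        ∀ f : ℂ → ℂ, TadmorRitt.MemBesov f →
          TadmorRitt.starNorm f < ⊤ ∧
          Summable (fun n : ℕ =>
            ‖Polynomial.aeval T (TadmorRitt.conv (TadmorRitt.W n) f)‖) ∧
          ‖TadmorRitt.besovCalculus T f‖ ≤
            a * TadmorRitt.rittConst T * Real.log (TadmorRitt.rittConst T + 1) *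
              (TadmorRitt.starNorm f).toReal := by
  refine ⟨432 * Real.pi, by positivity, fun X _ _ _ T hT f hf => ?_⟩
  have hstar := TadmorRitt.starNorm_lt_top hf
  have hle := TadmorRitt.norm_aeval_conv_W_le hT f
  have hsum := (ENNReal.summable_toReal hstar.ne).mul_left
    (432 * Real.pi * TadmorRitt.rittConst T * Real.log (TadmorRitt.rittConst T + 1))
  have hs : Summable fun n : ℕ =>
      ‖Polynomial.aeval T (TadmorRitt.conv (TadmorRitt.W n) f)‖ :=
    Summable.of_nonneg_of_le (fun _ => norm_nonneg _) hle hsum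
  refine ⟨hstar, hs, (norm_tsum_le_tsum_norm hs).trans ((hs.tsum_le_tsum hle hsum).trans_eq ?_)⟩
  rw [tsum_mul_left, TadmorRitt.starNorm,
    ENNReal.tsum_toReal_eq fun n => (TadmorRitt.supNorm_eval_lt_top _).ne]
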